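/- Let $E$ be a real separable Banach space with topological dual $E'$. For a Borel probability measure $\mu$ on $E$ let $\hat\mu(y)=\int_E e^{i\langle y,x\rangle}\,\mu(dx)$, $y\in E'$, be its characteristic function. Let $ID_{\log}$ be the set of all infinitely divisible Borel probability measures $\mu$ on $E$ with $\int_E \log(1+\|x\|)\,\mu(dx)<\infty$. For infinitely divisible $\mu$, let $\log\hat\mu$ denote the unique (norm-)continuous function $\Phi:E'\to\mathbb{C}$ with $\Phi(0)=0$ and $e^{\Phi(y)}=\hat\mu(y)$ for all $y\in E'$. Let $\nu,\rho\in ID_{\log}$. Then $\log\hat\nu$ and $\log\hat\rho$ exist, and for every $y\in E'$ the integrals $\int_0^\infty \log\hat\nu(e^{-s}y)\,ds$, $\int_0^\infty \log\hat\rho(e^{-s}y)\,ds$ and $\int_0^1\log\hat\rho(sy)\,ds$ converge absolutely. Moreover, $$\exp\Big(\int_0^\infty \log\hat\nu(e^{-s}y)\,ds\Big)\cdot\hat\nu(y)=\exp\int_0^\infty \log\hat\rho(e^{-s}y)\,ds\qquad\text{for all } y\in E'$$ if and only if $$\hat\nu(y)=\exp\int_0^1\log\hat\rho(sy)\,ds\qquad\text{for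 all } y\in E'.$$ -/

import Mathlib

open MeasureTheory Set

noncomputable section

/-- The `n`-fold convolution power of a measure, with the zeroth power equal to the unit mass
at the origin. -/
def convPow {E : Type*} [AddMonoid E] [MeasurableSpace E] (μ : Measure E) : ℕ → Measure E
  | 0 => Measure.dirac 0
  | n + 1 => Measure.conv (convPow μ n) μ

/-- `ID(E)`: the infinitely divisible Borel probability measures, that is, those which have,
for every `n ≥ 1`, an `n`-th convolution root that is a probability measure. -/
def ID (E : Type*) [AddMonoid E] [MeasurableSpace E] : Set (ProbabilityMeasure E) :=
  {μ | ∀ n : ℕ, 1 ≤ n → ∃ μn : ProbabilityMeasure E, convPow (μn : Measure E) n = (μ : Measure E)}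

/-- `ID_log(E)`: the infinitely divisible probability measures with finite logarithmic moment. -/
def IDlog (E : Type*) [NormedAddCommGroup E] [MeasurableSpace E] : Set (ProbabilityMeasure E) :=
  {μ | μ ∈ ID E ∧ Integrable (fun x : E => Real.log (1 + ‖x‖)) (μ : Measure E)}

/-- `Φ` is the continuous logarithm of the characteristic function of `μ`: the (necessarily
unique) continuous function on the dual space that vanishes at `0` and satisfies
`exp (Φ y) = ∫ exp (i ⟨y, x⟩) μ(dx)` for all `y`. -/
structure IsLogCharFun {E : Type*} [NormedAddCommGroup E] [NormedSpace ℝ E] [MeasurableSpace E]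
    (μ : Measure E) (Φ : StrongDual ℝ E → ℂ) : Prop where
  continuous : Continuous Φ
  map_zero : Φ 0 = 0
  exp_eq : ∀ y : StrongDual ℝ E, Complex.exp (Φ y) = charFunDual μ y

open Classical in
/-- The continuous logarithm `log μ̂` of the characteristic function of `μ` (the Lévy exponent,
if `μ` is infinitely divisible); it is `0` by convention if there is no such logarithm. -/
def logCharFun {E : Type*} [NormedAddCommGroup E] [NormedSpace ℝ E] [MeasurableSpace E]
    (μ : Measure E) : StrongDual ℝ E → ℂ :=
  if h : ∃ Φ : StrongDual ℝ E → ℂ, IsLogCharFun μ Φ then h.choose else 0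

end

open Filter Topology

/-! Fix `y` and put g(r) = log ν̂(e^{-r}y), h(r) = log ρ̂(e^{-r}y). Read at the points e^{-r}y, the
two identities become, up to exponentials, ∫_r^∞ g + g(r) = ∫_r^∞ h and, after substituting u =
e^{-s}, e^{-r}g(r) = ∫_r^∞ e^{-s}h(s) ds. Both are the equation g' = g - h with decay at infinity
(`integral_Ioi_add_eq_integral_Ioi_iff`). The exponentials can be dropped because both exponents are
continuous in r and tend to 0 (`eq_of_exp_eq_of_tendsto`). The logarithms exist because infinitely
divisible characteristic functions have no zeros (`charFunDual_ne_zero_of_mem_ID`); the log-moment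
makes the integrals converge (`IsLogCharFun.integrableOn_exp_neg_smul`). -/

theorem charFunDual_zero_of_isProbabilityMeasure {E : Type*} [NormedAddCommGroup E]
    [NormedSpace ℝ E] [MeasurableSpace E] (μ : Measure E) [IsProbabilityMeasure μ] :
    charFunDual μ 0 = 1 := by
  simp [charFunDual_apply]

theorem isProbabilityMeasure_convPow {E : Type*} [NormedAddCommGroup E]
    [MeasurableSpace E] [BorelSpace E] [SecondCountableTopology E] (μ : Measure E)
    [IsProbabilityMeasure μ] (n : ℕ) :
    IsProbabilityMeasure (convPow μ n) := by
  induction n with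
  | zero => exact Measure.dirac.isProbabilityMeasure
  | succ n ih =>
    rw [convPow]
    infer_instance

/-! ### Non-vanishing characteristic functions and their logarithms -/

section CharFunDual

variable {E : Type*} [NormedAddCommGroup E] [NormedSpace ℝ E] [MeasurableSpace E] [BorelSpace E]

theorem integrable_exp_dual_mul_I (μ : Measure E) [IsFiniteMeasure μ] (y : StrongDual ℝ E) :
    Integrable (fun x : E => Complex.exp (y x * Complex.I)) μ :=
  (integrable_const (1 : ℝ)).mono (Measurable.aestronglyMeasurable (by fun_prop))
    (by simp [Complex.norm_exp_ofReal_mul_I])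

theorem continuous_charFunDual (μ : Measure E) [IsFiniteMeasure μ] :
    Continuous (charFunDual μ) := by
  simp only [funext (charFunDual_apply (μ := μ))]
  refine continuous_of_dominated (bound := fun _ => 1)
    (fun y => (integrable_exp_dual_mul_I μ y).aestronglyMeasurable) (fun y => ?_)
    (integrable_const _) (ae_of_all _ fun x => ?_)
  · simp [Complex.norm_exp_ofReal_mul_I]
  · have : Continuous fun y : StrongDual ℝ E => y x := by fun_prop
    fun_prop

theorem re_charFunDual (μ : Measure E) [IsFiniteMeasure μ] (y : StrongDual ℝ E) :
    (charFunDual μ y).re = ∫ x, Real.cos (y x) ∂μ := by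
  rw [charFunDual_apply, ← RCLike.re_eq_complex_re, ← integral_re (integrable_exp_dual_mul_I μ y)]
  simp [Complex.exp_ofReal_mul_I_re]

/-- Integrates cos 2t - (4 cos t - 3) = 2(cos t - 1)² ≥ 0. -/
theorem four_mul_re_charFunDual_sub_three_le (μ : Measure E) [IsProbabilityMeasure μ]
    (y : StrongDual ℝ E) :
    4 * (charFunDual μ y).re - 3 ≤ (charFunDual μ ((2 : ℝ) • y)).re := by
  have hi (z : StrongDual ℝ E) : Integrable (fun x => Real.cos (z x)) μ :=
    (integrable_const (1 : ℝ)).mono (Measurable.aestronglyMeasurable (by fun_prop))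
      (ae_of_all _ fun x => by simpa using Real.abs_cos_le_one _)
  rw [re_charFunDual, re_charFunDual]
  calc 4 * ∫ x, Real.cos (y x) ∂μ - 3 = ∫ x, (4 * Real.cos (y x) - 3) ∂μ := by
        rw [integral_sub ((hi y).const_mul 4) (integrable_const _), integral_const_mul]
        simp
    _ ≤ ∫ x, Real.cos (((2 : ℝ) • y) x) ∂μ := by
        refine integral_mono (((hi y).const_mul 4).sub (integrable_const _)) (hi _) fun x => ?_
        simp only [smul_apply, smul_eq_mul, Real.cos_two_mul]
        nlinarith [sq_nonneg (Real.cos (y x) - 1)]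

theorem charFunDual_map_neg (μ : Measure E) (y : StrongDual ℝ E) :
    charFunDual (μ.map (fun x => -x)) y = (starRingEnd ℂ) (charFunDual μ y) := by
  rw [charFunDual_apply, charFunDual_apply, integral_map (by fun_prop)
    (Measurable.aestronglyMeasurable (by fun_prop)), ← integral_conj]
  refine integral_congr_ae (ae_of_all _ fun x => ?_)
  simp [← Complex.exp_conj]

variable [SecondCountableTopology E]

/-- Symmetrization: convolving `μ` with its reflection gives the characteristic function |μ̂|². -/
theorem four_mul_normSq_charFunDual_sub_three_le (μ : Measure E) [IsProbabilityMeasure μ]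
    (y : StrongDual ℝ E) :
    4 * Complex.normSq (charFunDual μ y) - 3 ≤
      Complex.normSq (charFunDual μ ((2 : ℝ) • y)) := by
  have : IsProbabilityMeasure (μ.map (fun x => -x)) :=
    Measure.isProbabilityMeasure_map (by fun_prop)
  have key := four_mul_re_charFunDual_sub_three_le (Measure.conv μ (μ.map (fun x => -x))) y
  simpa only [charFunDual_conv, charFunDual_map_neg, Complex.mul_conj, Complex.ofReal_re] using key

theorem charFunDual_convPow (μ : Measure E) [IsProbabilityMeasure μ] (n : ℕ)
    (y : StrongDual ℝ E) : charFunDual (convPow μ n) y = charFunDual μ y ^ n := by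
  induction n with
  | zero => simp [convPow]
  | succ n ih =>
    have := isProbabilityMeasure_convPow μ n
    rw [convPow, charFunDual_conv, ih, pow_succ]

theorem charFunDual_two_smul_ne_zero_of_mem_ID {μ : ProbabilityMeasure E} (hμ : μ ∈ ID E)
    {y : StrongDual ℝ E} (hy : charFunDual (μ : Measure E) y ≠ 0) :
    charFunDual (μ : Measure E) ((2 : ℝ) • y) ≠ 0 := by
  set c := Complex.normSq (charFunDual (μ : Measure E) y) with hc
  have hc0 : 0 < c := Complex.normSq_pos.2 hy
  -- A root of high order has |κ̂(y)|² > 3/4, exactly what makes the lower bound 4|κ̂(y)|² - 3 for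
  -- |κ̂(2y)|² positive.
  obtain ⟨n, hn⟩ := exists_pow_lt_of_lt_one hc0 (by norm_num : (3 / 4 : ℝ) < 1)
  obtain ⟨κ, hκ⟩ := hμ (n + 1) (by omega)
  have hroot (z : StrongDual ℝ E) :
      charFunDual (μ : Measure E) z = charFunDual (κ : Measure E) z ^ (n + 1) := by
    rw [← hκ, charFunDual_convPow]
  have hlt : 3 / 4 < Complex.normSq (charFunDual (κ : Measure E) y) := by
    by_contra! hle
    have h1 : c ≤ (3 / 4) ^ (n + 1) := by
      rw [hc, hroot, map_pow]
      exact pow_le_pow_left₀ (Complex.normSq_nonneg _) hle _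
    have h2 : (3 / 4 : ℝ) ^ (n + 1) ≤ (3 / 4) ^ n :=
      pow_le_pow_of_le_one (by norm_num) (by norm_num) (by omega)
    linarith
  rw [hroot]
  refine pow_ne_zero _ (Complex.normSq_pos.1 ?_)
  linarith [four_mul_normSq_charFunDual_sub_three_le (κ : Measure E) y]

/-- Halve `y` until continuity at 0 gives a nonzero value, then double back. -/
theorem charFunDual_ne_zero_of_mem_ID {μ : ProbabilityMeasure E} (hμ : μ ∈ ID E)
    (y : StrongDual ℝ E) : charFunDual (μ : Measure E) y ≠ 0 := by
  have hlim : Tendsto (fun k : ℕ => ((1 / 2 : ℝ) ^ k) • y) atTop (𝓝 0) := by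
    simpa using (tendsto_pow_atTop_nhds_zero_of_lt_one (by norm_num)
      (by norm_num : (1 / 2 : ℝ) < 1)).smul_const y
  have hev := ((continuous_charFunDual (μ : Measure E)).tendsto 0).comp hlim
  rw [charFunDual_zero_of_isProbabilityMeasure] at hev
  obtain ⟨k, hk⟩ := (hev.eventually_ne one_ne_zero).exists
  have hind (j : ℕ) : charFunDual (μ : Measure E) ((2 : ℝ) ^ j • ((1 / 2 : ℝ) ^ k) • y) ≠ 0 := by
    induction j with
    | zero => simpa using hk
    | succ j ih =>
      rw [pow_succ', mul_smul]
      exact charFunDual_two_smul_ne_zero_of_mem_ID hμ ih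
  have := hind k
  rwa [smul_smul, ← mul_pow, mul_one_div_cancel two_ne_zero, one_pow, one_smul] at this

theorem isLogCharFun_logCharFun_of_mem_ID {μ : ProbabilityMeasure E} (hμ : μ ∈ ID E) :
    IsLogCharFun (μ : Measure E) (logCharFun (μ : Measure E)) := by
  have hex : ∃ Φ : StrongDual ℝ E → ℂ, IsLogCharFun (μ : Measure E) Φ := by
    -- The dual, being a normed space, is simply connected, so a map avoiding 0 lifts through the
    -- exponential covering.
    obtain ⟨Φ, ⟨h0, hΦ⟩, -⟩ := Complex.isCoveringMapOn_exp.existsUnique_continuousMap_lifts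
      ⟨charFunDual (μ : Measure E), continuous_charFunDual _⟩ (a₀ := 0) (e₀ := 0)
      (by simp [charFunDual_zero_of_isProbabilityMeasure])
      (fun y => charFunDual_ne_zero_of_mem_ID hμ y)
    exact ⟨Φ, Φ.continuous, h0, fun y => congr_fun hΦ y⟩
  rw [logCharFun, dif_pos hex]
  exact hex.choose_spec

end CharFunDual

/-! ### Integrability from the logarithmic moment -/

theorem min_two_le_three_mul_div {z : ℝ} (hz : 0 ≤ z) : min 2 z ≤ 3 * (z / (1 + z)) := by
  rw [← mul_div_assoc, le_div_iff₀ (by positivity)]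
  rcases le_total z 2 with h | h
  · rw [min_eq_right h]; nlinarith
  · rw [min_eq_left h]; linarith

theorem norm_exp_ofReal_mul_I_sub_one_le_min (t : ℝ) :
    ‖Complex.exp (t * Complex.I) - 1‖ ≤ min 2 |t| := by
  refine le_min ((norm_sub_le _ _).trans ?_) ?_
  · rw [Complex.norm_exp_ofReal_mul_I]; norm_num
  · simpa [mul_comm] using Real.norm_exp_I_mul_ofReal_sub_one_le (x := t)

/-- Since |e^z - 1 - z| ≤ |z|² ≤ |z|/2. This transfers integrability from μ̂ - 1 to log μ̂. -/
theorem norm_le_two_mul_norm_exp_sub_one {z : ℂ} (hz : ‖z‖ ≤ 1 / 2) :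
    ‖z‖ ≤ 2 * ‖Complex.exp z - 1‖ := by
  have h1 := Complex.norm_exp_sub_one_sub_id_le (x := z) (by linarith)
  have h2 := norm_sub_norm_le z (Complex.exp z - 1)
  rw [norm_sub_rev z] at h2
  nlinarith [norm_nonneg z]

theorem hasDerivAt_neg_log_one_add_exp_neg_mul {a : ℝ} (ha : 0 ≤ a) (s : ℝ) :
    HasDerivAt (fun s : ℝ => -Real.log (1 + Real.exp (-s) * a))
      (Real.exp (-s) * a / (1 + Real.exp (-s) * a)) s := by
  have h : HasDerivAt (fun s : ℝ => 1 + Real.exp (-s) * a) (-(Real.exp (-s) * a)) s := by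
    simpa using (((hasDerivAt_neg s).exp).mul_const a).const_add 1
  simpa [neg_div] using (h.log (by positivity)).fun_neg

theorem tendsto_neg_log_one_add_exp_neg_mul (a : ℝ) :
    Tendsto (fun s : ℝ => -Real.log (1 + Real.exp (-s) * a)) atTop (𝓝 0) := by
  have h1 : Tendsto (fun s : ℝ => 1 + Real.exp (-s) * a) atTop (𝓝 1) := by
    simpa using (Real.tendsto_exp_neg_atTop_nhds_zero.mul_const a).const_add 1
  simpa using (h1.log one_ne_zero).neg

theorem integrableOn_exp_neg_mul_div {a : ℝ} (ha : 0 ≤ a) :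
    IntegrableOn (fun s : ℝ => Real.exp (-s) * a / (1 + Real.exp (-s) * a)) (Ioi 0) :=
  integrableOn_Ioi_deriv_of_nonneg' (fun s _ => hasDerivAt_neg_log_one_add_exp_neg_mul ha s)
    (fun s _ => by positivity) (tendsto_neg_log_one_add_exp_neg_mul a)

/-- This is where the weight log(1 + ‖x‖) comes from: with a = ‖y‖‖x‖ the integrand dominates the
kernel e^{i⟨e^{-s}y,x⟩} - 1 up to a factor 3. -/
theorem integral_exp_neg_mul_div {a : ℝ} (ha : 0 ≤ a) :
    ∫ s in Ioi (0 : ℝ), Real.exp (-s) * a / (1 + Real.exp (-s) * a) = Real.log (1 + a) := by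
  rw [integral_Ioi_of_hasDerivAt_of_tendsto'
    (fun s _ => hasDerivAt_neg_log_one_add_exp_neg_mul ha s) (integrableOn_exp_neg_mul_div ha)
    (tendsto_neg_log_one_add_exp_neg_mul a)]
  simp

theorem log_one_add_mul_le {a b : ℝ} (ha : 0 ≤ a) (hb : 0 ≤ b) :
    Real.log (1 + a * b) ≤ Real.log (1 + a) + Real.log (1 + b) := by
  rw [← Real.log_mul (by positivity) (by positivity)]
  exact Real.log_le_log (by positivity) (by nlinarith)

theorem norm_exp_smul_dual_sub_one_le {E : Type*} [NormedAddCommGroup E] [NormedSpace ℝ E]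
    (y : StrongDual ℝ E) (x : E) (s : ℝ) :
    ‖Complex.exp (((Real.exp (-s) • y) x : ℝ) * Complex.I) - 1‖ ≤
      3 * (Real.exp (-s) * (‖y‖ * ‖x‖) / (1 + Real.exp (-s) * (‖y‖ * ‖x‖))) := by
  refine ((norm_exp_ofReal_mul_I_sub_one_le_min _).trans (min_le_min_left _ ?_)).trans
    (min_two_le_three_mul_div (by positivity))
  rw [smul_apply, smul_eq_mul, abs_mul, Real.abs_exp]
  gcongr
  exact y.le_opNorm x

theorem tendsto_exp_neg_smul_atTop {E : Type*} [NormedAddCommGroup E] [NormedSpace ℝ E]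
    (y : StrongDual ℝ E) :
    Tendsto (fun s : ℝ => Real.exp (-s) • y) atTop (𝓝 0) := by
  simpa using Real.tendsto_exp_neg_atTop_nhds_zero.smul_const y

theorem IsLogCharFun.tendsto_exp_neg_smul {E : Type*} [NormedAddCommGroup E] [NormedSpace ℝ E]
    [MeasurableSpace E] {μ : Measure E} {Φ : StrongDual ℝ E → ℂ} (hΦ : IsLogCharFun μ Φ)
    (y : StrongDual ℝ E) : Tendsto (fun s : ℝ => Φ (Real.exp (-s) • y)) atTop (𝓝 0) := by
  simpa [hΦ.map_zero, Function.comp_def] using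
    (hΦ.continuous.tendsto 0).comp (tendsto_exp_neg_smul_atTop y)

theorem IsLogCharFun.continuous_exp_neg_smul {E : Type*} [NormedAddCommGroup E] [NormedSpace ℝ E]
    [MeasurableSpace E] {μ : Measure E} {Φ : StrongDual ℝ E → ℂ} (hΦ : IsLogCharFun μ Φ)
    (y : StrongDual ℝ E) : Continuous fun s : ℝ => Φ (Real.exp (-s) • y) :=
  hΦ.continuous.comp (by fun_prop)

section Integrability

variable {E : Type*} [NormedAddCommGroup E] [NormedSpace ℝ E] [MeasurableSpace E] [BorelSpace E]

variable [SecondCountableTopology E]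

theorem integrableOn_charFunDual_exp_neg_smul_sub_one (μ : Measure E) [IsProbabilityMeasure μ]
    (hμ : Integrable (fun x : E => Real.log (1 + ‖x‖)) μ) (y : StrongDual ℝ E) :
    IntegrableOn (fun s : ℝ => charFunDual μ (Real.exp (-s) • y) - 1) (Ioi 0) := by
  set k : ℝ × E → ℂ :=
    fun p => Complex.exp (((Real.exp (-p.1) • y) p.2 : ℝ) * Complex.I) - 1 with hk
  have hcont : Continuous k := by
    simp only [hk, smul_apply, smul_eq_mul]
    fun_prop
  have hpt (x : E) : IntegrableOn (fun s => k (s, x)) (Ioi 0) :=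
    ((integrableOn_exp_neg_mul_div (a := ‖y‖ * ‖x‖) (by positivity)).const_mul 3).mono'
      (hcont.comp (by fun_prop : Continuous fun s : ℝ => (s, x))).aestronglyMeasurable
      (ae_of_all _ (norm_exp_smul_dual_sub_one_le y x))
  have hint : Integrable k ((volume.restrict (Ioi (0 : ℝ))).prod μ) := by
    -- Tonelli with `s` integrated first: the inner integral is at most 3 log(1 + ‖y‖‖x‖).
    rw [integrable_prod_iff' hcont.aestronglyMeasurable]
    refine ⟨ae_of_all _ hpt, ?_⟩
    refine Integrable.mono' (((integrable_const (Real.log (1 + ‖y‖))).add hμ).const_mul 3)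
      hcont.norm.stronglyMeasurable.integral_prod_left'.aestronglyMeasurable
      (ae_of_all _ fun x => ?_)
    rw [Real.norm_of_nonneg (integral_nonneg fun _ => norm_nonneg _)]
    calc ∫ s in Ioi (0 : ℝ), ‖k (s, x)‖
        ≤ ∫ s in Ioi (0 : ℝ),
          3 * (Real.exp (-s) * (‖y‖ * ‖x‖) / (1 + Real.exp (-s) * (‖y‖ * ‖x‖))) :=
          integral_mono (hpt x).norm
            ((integrableOn_exp_neg_mul_div (by positivity)).const_mul 3)
            (norm_exp_smul_dual_sub_one_le y x)
      _ = 3 * Real.log (1 + ‖y‖ * ‖x‖) := by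
          rw [integral_const_mul, integral_exp_neg_mul_div (by positivity)]
      _ ≤ 3 * (Real.log (1 + ‖y‖) + Real.log (1 + ‖x‖)) := by
          gcongr
          exact log_one_add_mul_le (norm_nonneg _) (norm_nonneg _)
  refine hint.integral_prod_left.congr (ae_of_all _ fun s => ?_)
  simp only [hk, charFunDual_apply]
  rw [integral_sub (integrable_exp_dual_mul_I μ _) (integrable_const _)]
  simp

theorem IsLogCharFun.integrableOn_exp_neg_smul {μ : Measure E} [IsProbabilityMeasure μ]
    {Φ : StrongDual ℝ E → ℂ} (hΦ : IsLogCharFun μ Φ)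
    (hμ : Integrable (fun x : E => Real.log (1 + ‖x‖)) μ) (y : StrongDual ℝ E) :
    IntegrableOn (fun s : ℝ => Φ (Real.exp (-s) • y)) (Ioi 0) := by
  refine ((hΦ.continuous_exp_neg_smul y).locallyIntegrable.locallyIntegrableOn _).integrableOn_of_isBigO_atTop
    (g := fun s : ℝ => charFunDual μ (Real.exp (-s) • y) - 1) ?_ ?_ |>.mono_set Ioi_subset_Ici_self
  · refine Asymptotics.IsBigO.of_bound 2 ?_
    have hsmall := (hΦ.tendsto_exp_neg_smul y).norm.eventually_le_const (u := 1 / 2) (by simp)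
    filter_upwards [hsmall] with s hs
    rw [← hΦ.exp_eq]
    exact norm_le_two_mul_norm_exp_sub_one hs
  · exact ⟨Ioi 0, Ioi_mem_atTop 0, integrableOn_charFunDual_exp_neg_smul_sub_one μ hμ y⟩

end Integrability

/-! ### Identities along a ray -/

/-- The difference is continuous with values in the discrete set 2πiℤ, hence constant, and its limit
is 0. -/
theorem eq_of_exp_eq_of_tendsto {f g : ℝ → ℂ} (hf : Continuous f) (hg : Continuous g)
    (hexp : ∀ r, Complex.exp (f r) = Complex.exp (g r)) (hf0 : Tendsto f atTop (𝓝 0))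
    (hg0 : Tendsto g atTop (𝓝 0)) : f = g := by
  have hconst (r s : ℝ) : f r - g r = f s - g s :=
    Complex.isCoveringMap_exp.const_of_comp (hf.sub hg)
      (fun a b => Subtype.ext (by simp [Complex.exp_sub, hexp])) r s
  have hlim : Tendsto (fun s => f s - g s) atTop (𝓝 0) := by simpa using hf0.sub hg0
  funext r
  rw [funext fun s => hconst s r] at hlim
  exact sub_eq_zero.1 (tendsto_nhds_unique tendsto_const_nhds hlim)

theorem integral_Ioi_comp_add_right {F : Type*} [NormedAddCommGroup F] [NormedSpace ℝ F]
    (f : ℝ → F) (a r : ℝ) : ∫ s in Ioi a, f (s + r) = ∫ s in Ioi (a + r), f s := by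
  have := (measurePreserving_add_right (volume : Measure ℝ) r).setIntegral_preimage_emb
    (measurableEmbedding_addRight r) f (Ioi (a + r))
  simpa using this

section TailIntegral

variable {f : ℝ → ℂ}

theorem integrableOn_Ioi_of_continuous (hf : Continuous f) (hi : IntegrableOn f (Ioi 0)) (r : ℝ) :
    IntegrableOn f (Ioi r) :=
  ((hf.integrableOn_Icc (a := r) (b := 0)).union hi).mono_set fun x hx => by
    rcases le_or_gt x 0 with h | h
    · exact Or.inl ⟨le_of_lt hx, h⟩
    · exact Or.inr h

theorem hasDerivAt_integral_Ioi (hf : Continuous f) (hi : IntegrableOn f (Ioi 0)) (r : ℝ) :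
    HasDerivAt (fun r => ∫ s in Ioi r, f s) (-f r) r := by
  have heq : (fun r => ∫ s in Ioi r, f s) = fun r => (∫ s in Ioi 0, f s) - ∫ s in (0 : ℝ)..r, f s := by
    funext t
    rw [← intervalIntegral.integral_interval_add_Ioi hi (integrableOn_Ioi_of_continuous hf hi t)]
    ring
  rw [heq]
  exact (hf.integral_hasStrictDerivAt 0 r).hasDerivAt.const_sub _

theorem tendsto_integral_Ioi_atTop (hi : IntegrableOn f (Ioi 0)) :
    Tendsto (fun r => ∫ s in Ioi r, f s) atTop (𝓝 0) := by
  have h := (intervalIntegral_tendsto_integral_Ioi 0 hi tendsto_id).const_sub (∫ s in Ioi 0, f s)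
  rw [sub_self] at h
  refine h.congr' ?_
  filter_upwards [eventually_ge_atTop 0] with r hr
  rw [← intervalIntegral.integral_interval_add_Ioi hi (hi.mono_set (Ioi_subset_Ioi hr))]
  simp

end TailIntegral

theorem hasDerivAt_ofReal_exp_neg (r : ℝ) :
    HasDerivAt (fun r : ℝ => (Real.exp (-r) : ℂ)) (-(Real.exp (-r) : ℂ)) r := by
  have := (hasDerivAt_neg r).exp.ofReal_comp
  simpa using this

theorem tendsto_ofReal_exp_neg_mul {g : ℝ → ℂ} (hg : Tendsto g atTop (𝓝 0)) :
    Tendsto (fun r : ℝ => (Real.exp (-r) : ℂ) * g r) atTop (𝓝 0) := by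
  have h : Tendsto (fun r : ℝ => (Real.exp (-r) : ℂ)) atTop (𝓝 0) := by
    exact_mod_cast (Complex.continuous_ofReal.tendsto 0).comp Real.tendsto_exp_neg_atTop_nhds_zero
  simpa using h.mul hg

theorem integrableOn_ofReal_exp_neg_mul {h : ℝ → ℂ} (hi : IntegrableOn h (Ioi 0)) :
    IntegrableOn (fun s : ℝ => (Real.exp (-s) : ℂ) * h s) (Ioi 0) := by
  refine hi.bdd_mul (c := 1) (Continuous.aestronglyMeasurable (by fun_prop)) ?_
  filter_upwards [ae_restrict_mem measurableSet_Ioi] with s hs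
  rw [Complex.norm_real, Real.norm_of_nonneg (Real.exp_pos _).le]
  exact Real.exp_le_one_iff.2 (by simpa using le_of_lt hs)

/-- Either side makes g differentiable with g' = g - h, i.e. (e^{-r}g)' = -e^{-r}h. Integrating one
form or the other up to infinity, where g and e^{-r}g vanish, gives the opposite side. -/
theorem integral_Ioi_add_eq_integral_Ioi_iff {g h : ℝ → ℂ} (hg : Continuous g) (hh : Continuous h)
    (hgi : IntegrableOn g (Ioi 0)) (hhi : IntegrableOn h (Ioi 0)) (hg0 : Tendsto g atTop (𝓝 0)) :
    (∀ r, (∫ s in Ioi r, g s) + g r = ∫ s in Ioi r, h s) ↔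
      ∀ r, (Real.exp (-r) : ℂ) * g r = ∫ s in Ioi r, (Real.exp (-s) : ℂ) * h s := by
  have hehi := integrableOn_ofReal_exp_neg_mul hhi
  have heh : Continuous fun s : ℝ => (Real.exp (-s) : ℂ) * h s := by fun_prop
  constructor
  · intro H
    have hgd (r : ℝ) : HasDerivAt g (g r - h r) r := by
      have hfun : g = fun r => (∫ s in Ioi r, h s) - ∫ s in Ioi r, g s :=
        funext fun r => by rw [← H r]; ring
      have hd := (hasDerivAt_integral_Ioi hh hhi r).sub (hasDerivAt_integral_Ioi hg hgi r)
      exact (hd.congr_of_eventuallyEq (EventuallyEq.of_eq hfun)).congr_deriv (by ring)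
    intro r
    have key := integral_Ioi_of_hasDerivAt_of_tendsto' (a := r)
      (f := fun r => -((Real.exp (-r) : ℂ) * g r)) (f' := fun s => (Real.exp (-s) : ℂ) * h s)
      (fun s _ => ?_) (integrableOn_Ioi_of_continuous heh hehi r)
      (by simpa using (tendsto_ofReal_exp_neg_mul hg0).neg)
    · rw [key]; ring
    · exact ((hasDerivAt_ofReal_exp_neg s).fun_mul (hgd s)).fun_neg.congr_deriv (by ring)
  · intro H
    have hgd (r : ℝ) : HasDerivAt g (g r - h r) r := by
      -- Differentiability of g is read off from g(r) = e^r ∫_r^∞ e^{-s}h(s) ds, with e^r written as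
      -- e^{-(-r)}.
      have hd := (hasDerivAt_ofReal_exp_neg (-r)).scomp r (hasDerivAt_neg r)
      have hd := hd.mul (hasDerivAt_integral_Ioi heh hehi r)
      have hexp (t : ℝ) : (Real.exp (- -t) : ℂ) * Real.exp (-t) = 1 := by
        rw [← Complex.ofReal_mul, ← Real.exp_add]; simp
      refine (hd.congr_of_eventuallyEq (Eventually.of_forall fun t => ?_)).congr_deriv ?_
      · simp only [Function.comp_apply, Pi.mul_apply]
        rw [← H t, ← mul_assoc, hexp, one_mul]
      · simp only [Function.comp_apply, neg_smul, one_smul]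
        rw [← H r]
        linear_combination (g r - h r) * hexp r
    intro r
    have key := integral_Ioi_of_hasDerivAt_of_tendsto' (a := r) (f := g)
      (f' := fun s => g s - h s) (fun s _ => hgd s)
      ((integrableOn_Ioi_of_continuous hg hgi r).sub (integrableOn_Ioi_of_continuous hh hhi r)) hg0
    rw [integral_sub (integrableOn_Ioi_of_continuous hg hgi r)
      (integrableOn_Ioi_of_continuous hh hhi r)] at key
    linear_combination key

/-- Substituting u = e^{-s} gives the integral of `H` over [0, e^{-r}], which is then rescaled to
[0, 1]. -/
theorem integral_Ioi_exp_neg_mul_comp_exp_neg {H : ℝ → ℂ} (hH : Continuous H)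
    (hi : IntegrableOn (fun s : ℝ => H (Real.exp (-s))) (Ioi 0)) (r : ℝ) :
    ∫ s in Ioi r, (Real.exp (-s) : ℂ) * H (Real.exp (-s)) =
      (Real.exp (-r) : ℂ) * ∫ u in (0 : ℝ)..1, H (u * Real.exp (-r)) := by
  have hc : Continuous fun s : ℝ => (Real.exp (-s) : ℂ) * H (Real.exp (-s)) := by fun_prop
  have hprim (t : ℝ) : HasDerivAt (fun t => ∫ u in (0 : ℝ)..t, H u) (H t) t :=
    (hH.integral_hasStrictDerivAt 0 t).hasDerivAt
  have hlim : Tendsto (fun s : ℝ => -∫ u in (0 : ℝ)..Real.exp (-s), H u) atTop (𝓝 0) := by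
    simpa [Function.comp_def] using
      ((hprim 0).continuousAt.tendsto.comp Real.tendsto_exp_neg_atTop_nhds_zero).neg
  have key := integral_Ioi_of_hasDerivAt_of_tendsto' (a := r)
    (f := fun s : ℝ => -∫ u in (0 : ℝ)..Real.exp (-s), H u)
    (f' := fun s : ℝ => (Real.exp (-s) : ℂ) * H (Real.exp (-s))) (fun s _ => ?_)
    (integrableOn_Ioi_of_continuous hc (integrableOn_ofReal_exp_neg_mul hi) r) hlim
  · rw [key, intervalIntegral.integral_comp_mul_right H (Real.exp_pos _).ne', zero_mul, one_mul,
      Complex.real_smul, ← mul_assoc, ← Complex.ofReal_mul,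
      mul_inv_cancel₀ (Real.exp_pos _).ne']
    simp
  · simpa using ((hprim (Real.exp (-s))).scomp s (hasDerivAt_neg s).exp).fun_neg

theorem integral_Ioi_zero_exp_neg_smul {E : Type*} [NormedAddCommGroup E] [NormedSpace ℝ E]
    (Φ : StrongDual ℝ E → ℂ) (y : StrongDual ℝ E) (r : ℝ) :
    ∫ s in Ioi (0 : ℝ), Φ (Real.exp (-s) • Real.exp (-r) • y) =
      ∫ s in Ioi r, Φ (Real.exp (-s) • y) := by
  simpa [smul_smul, ← Real.exp_add, neg_add_rev, add_comm] using
    integral_Ioi_comp_add_right (fun s => Φ (Real.exp (-s) • y)) 0 r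

/-! ### The equivalence for characteristic functions -/

section Equivalence

variable {E : Type*} [NormedAddCommGroup E] [NormedSpace ℝ E] [MeasurableSpace E]
  {μ κ : Measure E} {Φ Ψ : StrongDual ℝ E → ℂ}

theorem IsLogCharFun.integral_Ioi_exp_neg_mul (hΨ : IsLogCharFun κ Ψ) {y : StrongDual ℝ E}
    (hi : IntegrableOn (fun s : ℝ => Ψ (Real.exp (-s) • y)) (Ioi 0)) (r : ℝ) :
    ∫ s in Ioi r, (Real.exp (-s) : ℂ) * Ψ (Real.exp (-s) • y) =
      (Real.exp (-r) : ℂ) * ∫ s in (0 : ℝ)..1, Ψ (s • Real.exp (-r) • y) := by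
  simpa only [smul_smul] using integral_Ioi_exp_neg_mul_comp_exp_neg (H := fun u => Ψ (u • y))
    (hΨ.continuous.comp (by fun_prop)) hi r

theorem IsLogCharFun.exp_integral_mul_eq_iff (hΦ : IsLogCharFun μ Φ) (hΨ : IsLogCharFun κ Ψ)
    (hΦi : ∀ y, IntegrableOn (fun s : ℝ => Φ (Real.exp (-s) • y)) (Ioi 0))
    (hΨi : ∀ y, IntegrableOn (fun s : ℝ => Ψ (Real.exp (-s) • y)) (Ioi 0)) :
    (∀ y : StrongDual ℝ E,
        Complex.exp (∫ s in Ioi (0 : ℝ), Φ (Real.exp (-s) • y)) * charFunDual μ y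
          = Complex.exp (∫ s in Ioi (0 : ℝ), Ψ (Real.exp (-s) • y))) ↔
      ∀ y : StrongDual ℝ E,
        charFunDual μ y = Complex.exp (∫ s in (0 : ℝ)..1, Ψ (s • y)) := by
  have hcΦ := hΦ.continuous_exp_neg_smul
  have hcΨ := hΨ.continuous_exp_neg_smul
  have hray (y : StrongDual ℝ E) := integral_Ioi_add_eq_integral_Ioi_iff (hcΦ y) (hcΨ y)
    (hΦi y) (hΨi y) (hΦ.tendsto_exp_neg_smul y)
  have hcI {f : ℝ → ℂ} (hf : Continuous f) (hi : IntegrableOn f (Ioi 0)) :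
      Continuous fun r => ∫ s in Ioi r, f s :=
    continuous_iff_continuousAt.2 fun r => (hasDerivAt_integral_Ioi hf hi r).continuousAt
  constructor
  · intro H y
    have h1 : (fun r : ℝ => (∫ s in Ioi r, Φ (Real.exp (-s) • y)) + Φ (Real.exp (-r) • y)) =
        fun r => ∫ s in Ioi r, Ψ (Real.exp (-s) • y) := by
      -- The hypothesis is needed at every e^{-r}y, not only at `y`: letting r → ∞ fixes the branch
      -- of the logarithm.
      refine eq_of_exp_eq_of_tendsto ((hcI (hcΦ y) (hΦi y)).add (hcΦ y)) (hcI (hcΨ y) (hΨi y))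
        (fun r => ?_) ?_ (tendsto_integral_Ioi_atTop (hΨi y))
      · rw [Complex.exp_add, hΦ.exp_eq, ← integral_Ioi_zero_exp_neg_smul Φ,
          ← integral_Ioi_zero_exp_neg_smul Ψ, H]
      · simpa using (tendsto_integral_Ioi_atTop (hΦi y)).add (hΦ.tendsto_exp_neg_smul y)
    have h2 := (hray y).1 (congr_fun h1) 0
    rw [hΨ.integral_Ioi_exp_neg_mul (hΨi y)] at h2
    rw [← hΦ.exp_eq]
    simpa using congr_arg Complex.exp h2
  · intro H y
    -- Continuity at t = 0 supplies the limit 0 along t = e^{-r}, which again fixes the branch.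
    have hcJ : Continuous fun t : ℝ => ∫ s in (0 : ℝ)..1, Ψ (s • t • y) := by
      refine intervalIntegral.continuous_parametric_intervalIntegral_of_continuous' ?_ 0 1
      exact hΨ.continuous.comp (by fun_prop)
    have hJ0 : Tendsto (fun r : ℝ => ∫ s in (0 : ℝ)..1, Ψ (s • Real.exp (-r) • y)) atTop (𝓝 0) := by
      simpa [hΨ.map_zero, Function.comp_def] using
        (hcJ.tendsto 0).comp Real.tendsto_exp_neg_atTop_nhds_zero
    have h1 : (fun r : ℝ => Φ (Real.exp (-r) • y)) =
        fun r => ∫ s in (0 : ℝ)..1, Ψ (s • Real.exp (-r) • y) :=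
      eq_of_exp_eq_of_tendsto (hcΦ y) (hcJ.comp (by fun_prop)) (fun r => by rw [hΦ.exp_eq, H])
        (hΦ.tendsto_exp_neg_smul y) hJ0
    have h2 := (hray y).2 (fun r => by
      rw [hΨ.integral_Ioi_exp_neg_mul (hΨi y), ← congr_fun h1 r]) 0
    rw [← hΦ.exp_eq, ← Complex.exp_add]
    simpa using congr_arg Complex.exp h2

end Equivalence

theorem corollary1 {E : Type*} [NormedAddCommGroup E] [NormedSpace ℝ E] [CompleteSpace E]
    [TopologicalSpace.SeparableSpace E] [MeasurableSpace E] [BorelSpace E]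
    (ν ρ : ProbabilityMeasure E) (hν : ν ∈ IDlog E) (hρ : ρ ∈ IDlog E) :
    -- the logarithms of the two characteristic functions exist
    (IsLogCharFun (ν : Measure E) (logCharFun (ν : Measure E)) ∧
      IsLogCharFun (ρ : Measure E) (logCharFun (ρ : Measure E))) ∧
    -- all the integrals converge absolutely
    (∀ y : StrongDual ℝ E,
      IntegrableOn (fun s : ℝ => logCharFun (ν : Measure E) (Real.exp (-s) • y)) (Ioi 0) ∧
      IntegrableOn (fun s : ℝ => logCharFun (ρ : Measure E) (Real.exp (-s) • y)) (Ioi 0) ∧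
      IntervalIntegrable (fun s : ℝ => logCharFun (ρ : Measure E) (s • y)) volume 0 1) ∧
    -- the equivalence
    ((∀ y : StrongDual ℝ E,
        Complex.exp (∫ s in Ioi (0 : ℝ), logCharFun (ν : Measure E) (Real.exp (-s) • y))
            * charFunDual (ν : Measure E) y
          = Complex.exp (∫ s in Ioi (0 : ℝ), logCharFun (ρ : Measure E) (Real.exp (-s) • y)))
      ↔
      ∀ y : StrongDual ℝ E,
        charFunDual (ν : Measure E) y
          = Complex.exp (∫ s in (0 : ℝ)..1, logCharFun (ρ : Measure E) (s • y))) := by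
  have hΦ := isLogCharFun_logCharFun_of_mem_ID hν.1
  have hΨ := isLogCharFun_logCharFun_of_mem_ID hρ.1
  have hΦi := hΦ.integrableOn_exp_neg_smul hν.2
  have hΨi := hΨ.integrableOn_exp_neg_smul hρ.2
  refine ⟨⟨hΦ, hΨ⟩, fun y => ⟨hΦi y, hΨi y, ?_⟩, hΦ.exp_integral_mul_eq_iff hΨ hΦi hΨi⟩
  exact (hΨ.continuous.comp (by fun_prop : Continuous fun s : ℝ => s • y)).intervalIntegrable 0 1
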